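/- Let $L>2\pi$, and let $\beta_1\in(1,\sqrt2)$ and $\beta_2>0$ with $\beta_2^2=2-\beta_1^2$ be such that the stationary snoidal wave $$S(x)=\beta_2\,\mathrm{sn}(\ell x;\kappa),\qquad \ell=\frac{\beta_1}{\sqrt2},\qquad \kappa=\frac{\beta_2}{\beta_1},$$ has fundamental (least positive) period $L$. Here $\mathrm{sn}(\cdot;\kappa)$ is the Jacobi elliptic function of modulus $\kappa$, that is, $\mathrm{sn}(u;\kappa)=\sin\varphi$ where $u=\int_0^{\varphi}\frac{d\theta}{\sqrt{1-\kappa^2\sin^2\theta}}$. Let $\mathcal L_s=-\partial_x^2-1+3S^2$ be the linearized operator around $S$ on $\mathbb T_L=\mathbb R/L\mathbb Z$, and for $\upsilon\in H^1(\mathbb T_L)$ let $$\langle\mathcal L_s\upsilon,\upsilon\rangle=\int_0^L\big(\upsilon_x^2-\upsilon^2+3S^2\upsilon^2\big)\,dx,\qquad \|\upsilon\|_{H^1(\mathbb T_L)}^2=\int_0^L\big(\upsilon_x^2+\upsilon^2\big)\,dx .$$ Then, for every real-valued odd function $\upsilon\in H^1(\mathbb T_L)$ (odd as an $L$-periodic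 function on the whole line), $$\langle\mathcal L_s\upsilon,\upsilon\rangle\ \ge\ \lambda^2\,\|\upsilon\|_{H^1(\mathbb T_L)}^2,\qquad \lambda^2=\frac{3\beta_2^2}{4+3\beta_2^2}.$$ -/

import Mathlib

open MeasureTheory
open scoped ContDiff

/-! Jacobi elliptic functions -/

/-- The incomplete elliptic integral of the first kind
`F(φ; k) = ∫_0^φ dθ / √(1 - k² sin² θ)`. -/
noncomputable def ellipticF (k φ : ℝ) : ℝ :=
  ∫ θ in (0 : ℝ)..φ, 1 / Real.sqrt (1 - k ^ 2 * Real.sin θ ^ 2)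

/-- The Jacobi amplitude `am(·; k)`: the inverse of `φ ↦ F(φ; k)`, which is a bijection of the
real line onto itself for `|k| < 1` (see `ellipticF_bijective`). -/
noncomputable def jacobiAm (k : ℝ) : ℝ → ℝ :=
  Function.invFun (ellipticF k)

/-- The snoidal function `sn(u; k) = sin φ`, where `u = F(φ; k)`. -/
noncomputable def jacobiSn (u k : ℝ) : ℝ :=
  Real.sin (jacobiAm k u)

theorem ellipticF_radicand_pos {k : ℝ} (hk : |k| < 1) (θ : ℝ) :
    0 < 1 - k ^ 2 * Real.sin θ ^ 2 := by
  have h1 : k ^ 2 < 1 := (sq_lt_one_iff_abs_lt_one k).2 hk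
  have h2 : Real.sin θ ^ 2 ≤ 1 := Real.sin_sq_le_one θ
  nlinarith [sq_nonneg k, sq_nonneg (Real.sin θ)]

theorem ellipticF_hasDerivAt {k : ℝ} (hk : |k| < 1) (φ : ℝ) :
    HasDerivAt (ellipticF k) (1 / Real.sqrt (1 - k ^ 2 * Real.sin φ ^ 2)) φ := by
  have hc : Continuous fun θ : ℝ => 1 / Real.sqrt (1 - k ^ 2 * Real.sin θ ^ 2) := by
    refine Continuous.div continuous_const (by fun_prop) fun θ => ?_
    exact (Real.sqrt_pos.2 (ellipticF_radicand_pos hk θ)).ne'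
  exact intervalIntegral.integral_hasDerivAt_right (hc.intervalIntegrable _ _)
    (hc.stronglyMeasurableAtFilter _ _) hc.continuousAt

theorem ellipticF_sub_id_monotone {k : ℝ} (hk : |k| < 1) :
    Monotone fun φ => ellipticF k φ - φ := by
  refine monotone_of_hasDerivAt_nonneg
    (fun φ => (ellipticF_hasDerivAt hk φ).sub (hasDerivAt_id φ)) fun φ => ?_
  have hpos := Real.sqrt_pos.2 (ellipticF_radicand_pos hk φ)
  have hle : Real.sqrt (1 - k ^ 2 * Real.sin φ ^ 2) ≤ 1 := by
    refine (Real.sqrt_le_sqrt (y := 1) ?_).trans_eq Real.sqrt_one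
    nlinarith [mul_nonneg (sq_nonneg k) (sq_nonneg (Real.sin φ))]
  have : 1 ≤ 1 / Real.sqrt (1 - k ^ 2 * Real.sin φ ^ 2) := by
    rwa [le_div_iff₀ hpos, one_mul]
  simpa using this

/-- So `jacobiAm k` is a genuine two-sided inverse. -/
theorem ellipticF_bijective {k : ℝ} (hk : |k| < 1) : Function.Bijective (ellipticF k) := by
  have hm := ellipticF_sub_id_monotone hk
  have h0 : ellipticF k 0 = 0 := by simp [ellipticF]
  have hs : StrictMono (ellipticF k) := fun a b hab => by
    have := hm hab.le
    simp only at this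
    linarith
  have hcont : Continuous (ellipticF k) :=
    continuous_iff_continuousAt.2 fun φ => (ellipticF_hasDerivAt hk φ).continuousAt
  refine ⟨hs.injective, hcont.surjective ?_ ?_⟩
  · refine Filter.tendsto_atTop_mono' _ ?_ Filter.tendsto_id
    filter_upwards [Filter.eventually_ge_atTop (0 : ℝ)] with φ hφ
    have := hm hφ
    simp only [h0] at this
    simp only [id]
    linarith
  · refine Filter.tendsto_atBot_mono' _ ?_ Filter.tendsto_id
    filter_upwards [Filter.eventually_le_atBot (0 : ℝ)] with φ hφ
    have := hm hφ
    simp only [h0] at this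
    simp only [id]
    linarith

/-! The stationary snoidal wave -/

/-- `S(x) = β₂ sn(ℓ x; κ)` with `ℓ = β₁ / √2` and `κ = β₂ / β₁`. -/
noncomputable def snoidalWave (β₁ β₂ x : ℝ) : ℝ :=
  β₂ * jacobiSn (β₁ / Real.sqrt 2 * x) (β₂ / β₁)

/-- `T` is the fundamental period of `f`: its least positive period. -/
def IsFundamentalPeriod (f : ℝ → ℝ) (T : ℝ) : Prop :=
  IsLeast {t : ℝ | 0 < t ∧ Function.Periodic f t} T

/-! The Sobolev space of the circle of length `L`; functions on the circle are `L`-periodic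
functions on the line. -/

/-- `f ∈ L²(𝕋_L)`. -/
def MemL2Per (L : ℝ) (f : ℝ → ℝ) : Prop :=
  Function.Periodic f L ∧ MemLp f 2 (volume.restrict (Set.Ioc 0 L))

/-- `g` is a weak derivative of `f` on `𝕋_L`, tested against smooth `L`-periodic functions. -/
def IsWeakDerivPer (L : ℝ) (f g : ℝ → ℝ) : Prop :=
  ∀ ψ : ℝ → ℝ, ContDiff ℝ ∞ ψ → Function.Periodic ψ L →
    ∫ x in (0 : ℝ)..L, f x * deriv ψ x = -∫ x in (0 : ℝ)..L, g x * ψ x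

/-- `f ∈ H¹(𝕋_L)`: `f` is in `L²(𝕋_L)` and has a weak derivative in `L²(𝕋_L)`. -/
def MemH1Per (L : ℝ) (f : ℝ → ℝ) : Prop :=
  MemL2Per L f ∧ ∃ g, MemL2Per L g ∧ IsWeakDerivPer L f g

open Classical in
/-- The weak derivative `f_x ∈ L²(𝕋_L)` of `f ∈ H¹(𝕋_L)` (unique up to null sets; zero by
convention if there is none). -/
noncomputable def weakDerivPer (L : ℝ) (f : ℝ → ℝ) : ℝ → ℝ :=
  if h : ∃ g, MemL2Per L g ∧ IsWeakDerivPer L f g then h.choose else 0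

/-- The norm of `H¹(𝕋_L)`, `‖f‖² = ∫_0^L (f_x² + f²)`. -/
noncomputable def h1NormPer (L : ℝ) (f : ℝ → ℝ) : ℝ :=
  Real.sqrt (∫ x in (0 : ℝ)..L, (weakDerivPer L f x ^ 2 + f x ^ 2))

/-- The pairing `⟨𝓛 f, h⟩` of `H⁻¹(𝕋_L)` and `H¹(𝕋_L)` for the operator
`𝓛 = -∂ₓ² - 1 + 3 S²` and `f, h ∈ H¹(𝕋_L)`, where `-∂ₓ² f` is taken in the weak sense:
`⟨-∂ₓ² f, h⟩ = ∫_0^L f_x h_x`. -/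
noncomputable def linearizedPairing (L : ℝ) (S f h : ℝ → ℝ) : ℝ :=
  ∫ x in (0 : ℝ)..L,
    (weakDerivPer L f x * weakDerivPer L h x - f x * h x + 3 * S x ^ 2 * (f x * h x))

/-! With `ℓ`, `κ` as in the wave, `φ(x) = sn(ℓx) dn(ℓx)` is odd and satisfies `𝓛 φ = μ φ`, `μ =
3β₂²/2`, and it is positive on `(0, L/2)`. An odd `L`-periodic `υ` vanishes at `0` and `±L/2`, so
Jacobi's argument applies on each half period: with `w = φ'/φ` the form of `𝓛 - μ` is the integral
of the square `(υ_x - w υ)²`, hence nonnegative (`integral_sq_deriv_add_nonneg_of_pos_solution`,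
`integral_odd_linearized_sub_eigenvalue_nonneg`).

This bounds the form below by `μ ∫ υ²`. To reach the `H¹` norm, take the convex combination with
weights `1 - c` and `c` of this bound and of the identity `⟨𝓛υ,υ⟩ = ∫(υ_x² - υ²) + 3∫S²υ²`; dropping
`3c∫S²υ² ≥ 0` and balancing the coefficients of `υ²` gives `c = μ/(2 + μ) = λ²`.

Point values of `υ` make sense through its absolutely continuous representative
(`IsWeakDerivPer.exists_absolutelyContinuous`). -/

theorem MeasureTheory.MemLp.intervalIntegrable_sq {g : ℝ → ℝ} {a b : ℝ} (hab : a ≤ b)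
    (hg : MemLp g 2 (volume.restrict (Set.Ioc a b))) :
    IntervalIntegrable (fun x => g x ^ 2) volume a b := by
  rw [intervalIntegrable_iff_integrableOn_Ioc_of_le hab]
  exact hg.integrable_sq

theorem MeasureTheory.MemLp.intervalIntegrable_two {g : ℝ → ℝ} {a b : ℝ} (hab : a ≤ b)
    (hg : MemLp g 2 (volume.restrict (Set.Ioc a b))) :
    IntervalIntegrable g volume a b := by
  rw [intervalIntegrable_iff_integrableOn_Ioc_of_le hab]
  exact hg.integrable one_le_two

/-! ### Jacobi's criterion for Dirichlet quadratic forms -/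

/-- Completing the square with a solution `w` of the Riccati equation `w' = q - w²`. -/
theorem integral_sq_deriv_add_nonneg_of_riccati {a b : ℝ} (hab : a ≤ b) {u g w q : ℝ → ℝ}
    (hu : AbsolutelyContinuousOnInterval u a b)
    (hug : ∀ᵐ x, x ∈ Set.uIcc a b → HasDerivAt u (g x) x)
    (hg : IntervalIntegrable g volume a b)
    (hg2 : IntervalIntegrable (fun x => g x ^ 2) volume a b)
    (hua : u a = 0) (hub : u b = 0)
    (hw : AbsolutelyContinuousOnInterval w a b)
    (hwq : ∀ x ∈ Set.uIcc a b, HasDerivAt w (q x - w x ^ 2) x)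
    (hq : ContinuousOn q (Set.uIcc a b)) :
    0 ≤ ∫ x in a..b, (g x ^ 2 + q x * u x ^ 2) := by
  have huc := hu.continuousOn
  have hwc := hw.continuousOn
  have hF := ((hu.fun_mul hu).fun_mul hw).integral_deriv_eq_sub
  -- The boundary terms of `u² w` vanish, so `(u² w)'` can be subtracted for free; what remains of
  -- the integrand is `(g - w u)²`.
  simp only [hua, hub, mul_zero, zero_mul, sub_zero] at hF
  have hd : ∫ x in a..b, deriv (fun x => u x * u x * w x) x =
      ∫ x in a..b, (2 * u x * w x * g x + u x ^ 2 * (q x - w x ^ 2)) := by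
    apply intervalIntegral.integral_congr_ae
    filter_upwards [hug] with x hx hxm
    have hxm' := Set.uIoc_subset_uIcc hxm
    have h : HasDerivAt (fun x => u x * u x * w x) _ x :=
      ((hx hxm').fun_mul (hx hxm')).fun_mul (hwq x hxm')
    rw [h.deriv]
    ring
  rw [hd] at hF
  have i1 : IntervalIntegrable (fun x => 2 * u x * w x * g x + u x ^ 2 * (q x - w x ^ 2))
      volume a b := by
    refine (hg.continuousOn_mul (by fun_prop)).add (ContinuousOn.intervalIntegrable (by fun_prop))
  have i2 : IntervalIntegrable (fun x => g x ^ 2 + q x * u x ^ 2) volume a b :=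
    hg2.add (ContinuousOn.intervalIntegrable (by fun_prop))
  have hs := intervalIntegral.integral_sub i2 i1
  rw [hF, sub_zero] at hs
  rw [← hs]
  refine intervalIntegral.integral_nonneg hab fun x _ => ?_
  nlinarith [sq_nonneg (g x - w x * u x)]

/-- A nonnegative solution of `φ'' = Q φ`, positive in the interior, makes the Dirichlet quadratic
form of `-∂ₓ² + Q` nonnegative. -/
theorem integral_sq_deriv_add_nonneg_of_pos_solution {a b : ℝ} (hab : a ≤ b)
    {u g φ φ' Q : ℝ → ℝ}
    (hu : AbsolutelyContinuousOnInterval u a b)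
    (hug : ∀ᵐ x, x ∈ Set.uIcc a b → HasDerivAt u (g x) x)
    (hg : IntervalIntegrable g volume a b)
    (hg2 : IntervalIntegrable (fun x => g x ^ 2) volume a b)
    (hua : u a = 0) (hub : u b = 0)
    (hφ : ∀ x, HasDerivAt φ (φ' x) x) (hφ' : ∀ x, HasDerivAt φ' (Q x * φ x) x)
    (hQ : Continuous Q) (hφpos : ∀ x ∈ Set.Ioo a b, 0 < φ x) :
    0 ≤ ∫ x in a..b, (g x ^ 2 + Q x * u x ^ 2) := by
  rcases hab.eq_or_lt with rfl | hab'
  · simp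
  have hφc : Continuous φ := continuous_iff_continuousAt.2 fun x => (hφ x).continuousAt
  have hφc' : Continuous φ' := continuous_iff_continuousAt.2 fun x => (hφ' x).continuousAt
  have huc := hu.continuousOn
  have hφ1 : ContDiff ℝ 1 φ := contDiff_one_iff_deriv.2
    ⟨fun x => (hφ x).differentiableAt, by
      rw [show deriv φ = φ' from funext fun x => (hφ x).deriv]; exact hφc'⟩
  have hφ1' : ContDiff ℝ 1 φ' := contDiff_one_iff_deriv.2
    ⟨fun x => (hφ' x).differentiableAt, by
      rw [show deriv φ' = fun x => Q x * φ x from funext fun x => (hφ' x).deriv]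
      exact hQ.mul hφc⟩
  have hnn : ∀ x ∈ Set.uIcc a b, 0 ≤ φ x := by
    rw [Set.uIcc_of_le hab, ← closure_Ioo hab'.ne]
    exact fun x hx => closure_minimal (s := Set.Ioo a b) (t := {x | 0 ≤ φ x})
      (fun y hy => (hφpos y hy).le) (isClosed_le continuous_const hφc) hx
  -- `φ'/φ` may blow up at the endpoints. The regularized `w = φ'/(φ + e)` solves the Riccati
  -- equation exactly with `q = Qφ/(φ + e)`, which is dominated by `|Q|` and tends to `Q` wherever
  -- `φ > 0`.
  have key : ∀ n : ℕ, 0 ≤ ∫ x in a..b,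
      (g x ^ 2 + Q x * φ x / (φ x + 1 / ((n : ℝ) + 1)) * u x ^ 2) := by
    intro n
    have he : (0 : ℝ) < 1 / ((n : ℝ) + 1) := by positivity
    set e := 1 / ((n : ℝ) + 1)
    have hne : ∀ x ∈ Set.uIcc a b, φ x + e ≠ 0 := fun x hx => by
      have := hnn x hx
      positivity
    refine integral_sq_deriv_add_nonneg_of_riccati hab hu hug hg hg2 hua hub
      (w := fun x => φ' x / (φ x + e)) ?_ ?_ ?_
    · refine ContDiffOn.absolutelyContinuousOnInterval ?_
      exact hφ1'.contDiffOn.div (hφ1.add contDiff_const).contDiffOn hne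
    · intro x hx
      refine ((hφ' x).div ((hφ x).add_const e) (hne x hx)).congr_deriv ?_
      have := hne x hx
      field_simp
    · exact ContinuousOn.div (by fun_prop) (by fun_prop) hne
  have hlim : Filter.Tendsto (fun n : ℕ => ∫ x in a..b,
      (g x ^ 2 + Q x * φ x / (φ x + 1 / ((n : ℝ) + 1)) * u x ^ 2)) Filter.atTop
      (nhds (∫ x in a..b, (g x ^ 2 + Q x * u x ^ 2))) := by
    refine intervalIntegral.tendsto_integral_filter_of_dominated_convergence
      (fun x => g x ^ 2 + |Q x| * u x ^ 2) (Filter.Eventually.of_forall fun n => ?_)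
      (Filter.Eventually.of_forall fun n => ?_) ?_ ?_
    · refine IntervalIntegrable.aestronglyMeasurable_restrict_uIoc
        (hg2.add (ContinuousOn.intervalIntegrable ?_))
      refine (ContinuousOn.div (by fun_prop) (by fun_prop) fun x hx => ?_).mul (by fun_prop)
      have := hnn x hx
      positivity
    · refine Filter.Eventually.of_forall fun x hx => ?_
      have h0 := hnn x (Set.uIoc_subset_uIcc hx)
      have he : (0 : ℝ) < 1 / ((n : ℝ) + 1) := by positivity
      rw [mul_div_assoc]
      refine (norm_add_le _ _).trans ?_
      simp only [norm_mul, norm_pow, Real.norm_eq_abs, sq_abs]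
      gcongr
      have h1 : |φ x / (φ x + 1 / ((n : ℝ) + 1))| ≤ 1 := by
        rw [abs_of_nonneg (by positivity), div_le_one (by positivity)]
        linarith
      exact mul_le_of_le_one_right (abs_nonneg _) h1
    · exact hg2.add (ContinuousOn.intervalIntegrable (by fun_prop))
    · have hb : ∀ᵐ x : ℝ, x ≠ b := by simp [ae_iff, measure_singleton]
      filter_upwards [hb] with x hxb hx
      rw [Set.uIoc_of_le hab] at hx
      have hp := hφpos x ⟨hx.1, lt_of_le_of_ne hx.2 hxb⟩
      have h1 : Filter.Tendsto (fun n : ℕ => φ x + 1 / ((n : ℝ) + 1)) Filter.atTop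
          (nhds (φ x)) := by
        simpa using tendsto_one_div_add_atTop_nhds_zero_nat.const_add (φ x)
      have h2 := (((tendsto_const_nhds (x := Q x * φ x)).div h1 hp.ne').mul_const
        (u x ^ 2)).const_add (g x ^ 2)
      rwa [mul_div_cancel_right₀ _ hp.ne'] at h2
  exact ge_of_tendsto' hlim key

/-! ### Periodic Sobolev functions -/

/-- An `L²` function on `(0, L)` all of whose real Fourier coefficients vanish is zero. -/
theorem ae_eq_zero_of_fourier_integrals_eq_zero {L : ℝ} (hL : 0 < L) {h : ℝ → ℝ}
    (hh : MemLp h 2 (volume.restrict (Set.Ioc 0 L)))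
    (hc : ∀ n : ℤ, ∫ x in (0 : ℝ)..L, h x * Real.cos (2 * Real.pi * n / L * x) = 0)
    (hs : ∀ n : ℤ, ∫ x in (0 : ℝ)..L, h x * Real.sin (2 * Real.pi * n / L * x) = 0) :
    h =ᵐ[volume.restrict (Set.Ioc 0 L)] 0 := by
  have hi : IntervalIntegrable h volume 0 L := by
    rw [intervalIntegrable_iff_integrableOn_Ioc_of_le hL.le]
    exact hh.integrable one_le_two
  have hint : ∀ p : ℝ → ℝ, Continuous p →
      IntervalIntegrable (fun x => ((h x * p x : ℝ) : ℂ)) volume 0 L := fun p hp => by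
    have h1 := hi.mul_continuousOn hp.continuousOn
    rw [intervalIntegrable_iff] at h1 ⊢
    exact h1.ofReal
  have hcoeff : ∀ n : ℤ, fourierCoeffOn hL (fun x => (h x : ℂ)) n = 0 := by
    intro n
    rw [fourierCoeffOn_eq_integral]
    have he : ∀ x : ℝ, fourier (-n) (x : AddCircle (L - 0)) • (h x : ℂ) =
        ((h x * Real.cos (2 * Real.pi * (-n : ℤ) / L * x) : ℝ) : ℂ) +
        ((h x * Real.sin (2 * Real.pi * (-n : ℤ) / L * x) : ℝ) : ℂ) * Complex.I := by
      intro x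
      rw [fourier_coe_apply, sub_zero, show (2 * (Real.pi : ℂ) * Complex.I * ((-n : ℤ) : ℂ) * x / L)
        = ((2 * Real.pi * (-n : ℤ) / L * x : ℝ) : ℂ) * Complex.I by push_cast; ring,
        Complex.exp_mul_I, smul_eq_mul]
      push_cast
      ring
    simp_rw [he]
    rw [intervalIntegral.integral_add, intervalIntegral.integral_mul_const,
      intervalIntegral.integral_ofReal, intervalIntegral.integral_ofReal, hc, hs]
    · simp
    · exact hint _ (by fun_prop)
    · exact (hint _ (by fun_prop)).mul_const _
  -- Parseval's identity turns vanishing coefficients into a vanishing `L²` norm.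
  have hsum := tsum_sq_fourierCoeffOn hL hh.ofReal
  have hz : (∫ x in (0 : ℝ)..L, h x ^ 2) = 0 := by
    have h1 : (L - 0)⁻¹ • ∫ x in (0 : ℝ)..L, ‖((h x : ℝ) : ℂ)‖ ^ 2 = 0 := by
      refine hsum.symm.trans ?_
      simp [hcoeff]
    rw [smul_eq_zero] at h1
    simpa using h1.resolve_left (by simp [hL.ne'])
  rw [intervalIntegral.integral_of_le hL.le,
    integral_eq_zero_iff_of_nonneg (fun x => sq_nonneg _) hh.integrable_sq] at hz
  filter_upwards [hz] with x hx
  simpa using hx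

theorem Function.Periodic.ae_of_ae_restrict_Ioc {L : ℝ} (hL : 0 < L) {f u : ℝ → ℝ}
    (hf : Function.Periodic f L) (hu : Function.Periodic u L)
    (h : f =ᵐ[volume.restrict (Set.Ioc 0 L)] u) : f =ᵐ[volume] u := by
  rw [Filter.EventuallyEq, ae_restrict_iff' measurableSet_Ioc] at h
  have h2 : ∀ᵐ x : ℝ, ∀ n : ℤ, x + n • L ∈ Set.Ioc 0 L → f (x + n • L) = u (x + n • L) :=
    ae_all_iff.2 fun n =>
      (measurePreserving_add_right volume (n • L)).quasiMeasurePreserving.ae h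
  filter_upwards [h2] with x hx
  obtain ⟨n, hn, -⟩ := existsUnique_add_zsmul_mem_Ioc hL x 0
  rw [zero_add] at hn
  have := hx n hn
  rwa [hf.zsmul n x, hu.zsmul n x] at this

/-- A function in `H¹(𝕋_L)` has a periodic, locally absolutely continuous representative. -/
theorem IsWeakDerivPer.exists_absolutelyContinuous {L : ℝ} (hL : 0 < L) {f g : ℝ → ℝ}
    (hf : MemL2Per L f) (hg : MemL2Per L g) (hfg : IsWeakDerivPer L f g) :
    ∃ u : ℝ → ℝ, Continuous u ∧ Function.Periodic u L ∧ f =ᵐ[volume] u ∧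
      (∀ a b, AbsolutelyContinuousOnInterval u a b) ∧ ∀ᵐ x, HasDerivAt u (g x) x := by
  have hg0 : IntervalIntegrable g volume 0 L := by
    rw [intervalIntegrable_iff_integrableOn_Ioc_of_le hL.le]
    exact hg.2.integrable one_le_two
  have hf0 : IntervalIntegrable f volume 0 L := by
    rw [intervalIntegrable_iff_integrableOn_Ioc_of_le hL.le]
    exact hf.2.integrable one_le_two
  have hgi : ∀ a b, IntervalIntegrable g volume a b := hg.1.intervalIntegrable₀ hL.ne' hg0
  -- Testing with `ψ = 1` gives `g` mean zero, which makes its primitive `G` periodic.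
  have hmean : ∫ x in (0 : ℝ)..L, g x = 0 := by
    have := hfg (fun _ => 1) contDiff_const (fun _ => rfl)
    simpa using this
  set G : ℝ → ℝ := fun x => ∫ t in (0 : ℝ)..x, g t with hG
  have hGc : Continuous G := intervalIntegral.continuous_primitive hgi 0
  have hG0 : G 0 = 0 := by simp [hG]
  have hGL : G L = 0 := hmean
  have hGp : Function.Periodic G L := fun x => by
    have h := hg.1.intervalIntegral_add_eq x 0
    rw [zero_add, hmean] at h
    have h2 := intervalIntegral.integral_add_adjacent_intervals (hgi 0 x) (hgi x (x + L))
    rw [h, add_zero] at h2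
    exact h2.symm
  have hGd : ∀ᵐ x, HasDerivAt G (g x) x := by
    have hl : LocallyIntegrable g volume := by
      refine (locallyIntegrable_iff).2 fun K hK => ?_
      obtain ⟨a, b, hab⟩ := bddBelow_bddAbove_iff_subset_Icc.1 ⟨hK.bddBelow, hK.bddAbove⟩
      exact (((intervalIntegrable_iff' (by simp)).1 (hgi a b)).mono_set Set.Icc_subset_uIcc).mono_set hab
    filter_upwards [LocallyIntegrable.ae_hasDerivAt_integral hl] with x hx using hx 0
  have hGac : ∀ a b, AbsolutelyContinuousOnInterval G a b := fun a b => by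
    have h := (hgi (min (min a b) 0) (max (max a b) 0)).absolutelyContinuousOnInterval_intervalIntegral
      (c := 0) ?_
    · refine h.mono ?_
      rw [Set.uIcc_subset_uIcc_iff_le]
      constructor <;> simp
    · rw [Set.uIcc_of_le (by simp)]; simp
  have hGm : MemLp G 2 (volume.restrict (Set.Ioc 0 L)) := by
    obtain ⟨C, hC⟩ := (isCompact_Icc (a := (0 : ℝ)) (b := L)).exists_bound_of_continuousOn
      hGc.continuousOn
    refine MemLp.of_bound hGc.aestronglyMeasurable C ?_
    rw [ae_restrict_iff' measurableSet_Ioc]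
    exact Filter.Eventually.of_forall fun x hx => hC x (Set.Ioc_subset_Icc_self hx)
  -- Derivatives of test functions miss the zeroth Fourier mode of `f - G`; subtracting its mean `c`
  -- removes that mode as well.
  set c : ℝ := (∫ x in (0 : ℝ)..L, (f x - G x)) / L with hcdef
  have hhi : IntervalIntegrable (fun x => f x - G x) volume 0 L :=
    hf0.sub (hGc.intervalIntegrable _ _)
  have hort : ∀ ψ : ℝ → ℝ, ContDiff ℝ ∞ ψ → Function.Periodic ψ L →
      ∫ x in (0 : ℝ)..L, (f x - G x - c) * deriv ψ x = 0 := by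
    intro ψ hψ hψp
    have hψd : Continuous (deriv ψ) := hψ.continuous_deriv (by simp)
    have hψac : AbsolutelyContinuousOnInterval ψ 0 L :=
      (hψ.of_le (by simp)).contDiffOn.absolutelyContinuousOnInterval
    have hψL : ψ L = ψ 0 := by simpa using hψp 0
    have h1 := (hGac 0 L).integral_mul_deriv_eq_deriv_mul hψac
    have h2 : ∫ x in (0 : ℝ)..L, deriv G x * ψ x = ∫ x in (0 : ℝ)..L, g x * ψ x := by
      apply intervalIntegral.integral_congr_ae
      filter_upwards [hGd] with x hx _
      rw [hx.deriv]
    have h3 : ∫ x in (0 : ℝ)..L, deriv ψ x = 0 := by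
      rw [hψac.integral_deriv_eq_sub, hψL, sub_self]
    rw [h2, hG0, hGL] at h1
    have h4 : ∀ x, (f x - G x - c) * deriv ψ x =
        f x * deriv ψ x - G x * deriv ψ x - c * deriv ψ x := fun x => by ring
    simp_rw [h4]
    have i1 : IntervalIntegrable (fun x => f x * deriv ψ x) volume 0 L :=
      hf0.mul_continuousOn hψd.continuousOn
    have i2 : IntervalIntegrable (fun x => G x * deriv ψ x) volume 0 L :=
      (hGc.mul hψd).intervalIntegrable _ _
    have i3 : IntervalIntegrable (fun x => c * deriv ψ x) volume 0 L :=
      (continuous_const.mul hψd).intervalIntegrable _ _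
    rw [intervalIntegral.integral_sub (i1.sub i2) i3, intervalIntegral.integral_sub i1 i2,
      intervalIntegral.integral_const_mul, h3, h1, hfg ψ hψ hψp]
    ring
  have hzero : ∫ x in (0 : ℝ)..L, (f x - G x - c) = 0 := by
    rw [intervalIntegral.integral_sub hhi (by simp), intervalIntegral.integral_const, hcdef]
    simp only [sub_zero, smul_eq_mul]
    field_simp
    ring
  have hper : ∀ n : ℤ, ∀ x : ℝ, 2 * Real.pi * n / L * (x + L) =
      2 * Real.pi * n / L * x + n * (2 * Real.pi) := fun n x => by field_simp
  have hae := ae_eq_zero_of_fourier_integrals_eq_zero hL (h := fun x => f x - G x - c)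
    ((hf.2.sub hGm).sub (memLp_const c)) ?_ ?_
  · refine ⟨fun x => c + G x, by fun_prop, fun x => by simp [hGp x], ?_, fun a b => ?_, ?_⟩
    · refine hf.1.ae_of_ae_restrict_Ioc hL (fun x => by simp [hGp x]) ?_
      filter_upwards [hae] with x hx
      simp only [Pi.zero_apply] at hx
      linarith
    · exact (contDiff_const (c := c)).contDiffOn.absolutelyContinuousOnInterval.fun_add (hGac a b)
    · filter_upwards [hGd] with x hx using hx.const_add c
  · intro n
    rcases eq_or_ne n 0 with rfl | hn
    · simpa using hzero
    have hk : 2 * Real.pi * n / L ≠ 0 := by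
      have : (n : ℝ) ≠ 0 := by exact_mod_cast hn
      have := Real.pi_ne_zero
      positivity
    have h := hort (fun x => Real.sin (2 * Real.pi * n / L * x)) (by fun_prop)
      (fun x => by simp only [hper]; exact Real.sin_add_int_mul_two_pi _ _)
    have hd : ∀ x, deriv (fun x => Real.sin (2 * Real.pi * n / L * x)) x =
        Real.cos (2 * Real.pi * n / L * x) * (2 * Real.pi * n / L) := fun x => by
      simpa using (((hasDerivAt_id x).const_mul (2 * Real.pi * n / L)).sin).deriv
    simp_rw [hd, ← mul_assoc] at h
    rw [intervalIntegral.integral_mul_const] at h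
    exact (mul_eq_zero.1 h).resolve_right hk
  · intro n
    rcases eq_or_ne n 0 with rfl | hn
    · simp
    have hk : 2 * Real.pi * n / L ≠ 0 := by
      have : (n : ℝ) ≠ 0 := by exact_mod_cast hn
      have := Real.pi_ne_zero
      positivity
    have h := hort (fun x => -Real.cos (2 * Real.pi * n / L * x)) (by fun_prop)
      (fun x => by simp only [hper]; rw [Real.cos_add_int_mul_two_pi])
    have hd : ∀ x, deriv (fun x => -Real.cos (2 * Real.pi * n / L * x)) x =
        Real.sin (2 * Real.pi * n / L * x) * (2 * Real.pi * n / L) := fun x => by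
      simpa using (((hasDerivAt_id x).const_mul (2 * Real.pi * n / L)).cos.neg).deriv
    simp_rw [hd, ← mul_assoc] at h
    rw [intervalIntegral.integral_mul_const] at h
    exact (mul_eq_zero.1 h).resolve_right hk

/-! ### Amplitude and `sn`: derivative, sign, half-period shift -/

theorem ellipticF_jacobiAm {k : ℝ} (hk : |k| < 1) (u : ℝ) : ellipticF k (jacobiAm k u) = u :=
  Function.rightInverse_invFun (ellipticF_bijective hk).surjective u

theorem jacobiAm_ellipticF {k : ℝ} (hk : |k| < 1) (φ : ℝ) : jacobiAm k (ellipticF k φ) = φ :=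
  Function.leftInverse_invFun (ellipticF_bijective hk).injective φ

theorem ellipticF_strictMono {k : ℝ} (hk : |k| < 1) : StrictMono (ellipticF k) := fun a b hab => by
  have := ellipticF_sub_id_monotone hk hab.le
  simp only at this
  linarith

theorem jacobiAm_strictMono {k : ℝ} (hk : |k| < 1) : StrictMono (jacobiAm k) := fun a b hab => by
  rwa [← (ellipticF_strictMono hk).lt_iff_lt, ellipticF_jacobiAm hk, ellipticF_jacobiAm hk]

theorem jacobiAm_continuous {k : ℝ} (hk : |k| < 1) : Continuous (jacobiAm k) :=
  (jacobiAm_strictMono hk).monotone.continuous_of_surjective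
    fun φ => ⟨ellipticF k φ, jacobiAm_ellipticF hk φ⟩

theorem jacobiAm_hasDerivAt {k : ℝ} (hk : |k| < 1) (u : ℝ) :
    HasDerivAt (jacobiAm k) (Real.sqrt (1 - k ^ 2 * Real.sin (jacobiAm k u) ^ 2)) u := by
  have hpos := Real.sqrt_pos.2 (ellipticF_radicand_pos hk (jacobiAm k u))
  have h := HasDerivAt.of_local_left_inverse (jacobiAm_continuous hk).continuousAt
    (ellipticF_hasDerivAt hk (jacobiAm k u)) (by positivity)
    (Filter.Eventually.of_forall (ellipticF_jacobiAm hk))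
  simpa using h

theorem jacobiAm_zero {k : ℝ} (hk : |k| < 1) : jacobiAm k 0 = 0 := by
  simpa [ellipticF] using jacobiAm_ellipticF hk 0

theorem ellipticF_add_pi {k : ℝ} (hk : |k| < 1) (φ : ℝ) :
    ellipticF k (φ + Real.pi) = ellipticF k φ + ellipticF k Real.pi := by
  have hc : Continuous fun θ : ℝ => 1 / Real.sqrt (1 - k ^ 2 * Real.sin θ ^ 2) :=
    Continuous.div continuous_const (by fun_prop) fun θ =>
      (Real.sqrt_pos.2 (ellipticF_radicand_pos hk θ)).ne'
  have hp : Function.Periodic (fun θ : ℝ => 1 / Real.sqrt (1 - k ^ 2 * Real.sin θ ^ 2))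
      Real.pi := fun θ => by simp [Real.sin_add_pi]
  have h := hp.intervalIntegral_add_eq φ 0
  simp only [zero_add] at h
  rw [ellipticF, ellipticF, ellipticF, ← h]
  exact (intervalIntegral.integral_add_adjacent_intervals (hc.intervalIntegrable _ _)
    (hc.intervalIntegrable _ _)).symm

theorem jacobiAm_add {k : ℝ} (hk : |k| < 1) (u : ℝ) :
    jacobiAm k (u + ellipticF k Real.pi) = jacobiAm k u + Real.pi := by
  apply (ellipticF_bijective hk).injective
  rw [ellipticF_jacobiAm hk, ellipticF_add_pi hk, ellipticF_jacobiAm hk]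

/-- `F(π; k)` is the classical `2K`, which the amplitude turns into a shift by `π`. -/
theorem jacobiSn_add {k : ℝ} (hk : |k| < 1) (u : ℝ) :
    jacobiSn (u + ellipticF k Real.pi) k = -jacobiSn u k := by
  rw [jacobiSn, jacobiSn, jacobiAm_add hk, Real.sin_add_pi]

theorem jacobiSn_pos {k u : ℝ} (hk : |k| < 1) (h0 : 0 < u) (h1 : u < ellipticF k Real.pi) :
    0 < jacobiSn u k := by
  apply Real.sin_pos_of_pos_of_lt_pi
  · simpa only [jacobiAm_zero hk] using jacobiAm_strictMono hk h0
  · simpa only [jacobiAm_ellipticF hk] using jacobiAm_strictMono hk h1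

theorem jacobiSn_neg_of_neg {k u : ℝ} (hk : |k| < 1) (h0 : -ellipticF k Real.pi < u)
    (h1 : u < 0) : jacobiSn u k < 0 := by
  have h := jacobiSn_pos hk (u := u + ellipticF k Real.pi) (by linarith) (by linarith)
  rw [jacobiSn_add hk] at h
  linarith

theorem continuous_snoidalWave {β₁ β₂ : ℝ} (hk : |β₂ / β₁| < 1) :
    Continuous (snoidalWave β₁ β₂) := by
  have := jacobiAm_continuous hk
  unfold snoidalWave jacobiSn
  fun_prop

/-- The half-period of the snoidal wave bounds from above half of its fundamental period. -/
theorem IsFundamentalPeriod.snoidalWave_le {L β₁ β₂ : ℝ} (hβ₁ : 0 < β₁) (hk : |β₂ / β₁| < 1)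
    (hS : IsFundamentalPeriod (snoidalWave β₁ β₂) L) :
    β₁ / Real.sqrt 2 * (L / 2) ≤ ellipticF (β₂ / β₁) Real.pi := by
  set l := β₁ / Real.sqrt 2 with hl
  set P := ellipticF (β₂ / β₁) Real.pi with hP
  have hlpos : 0 < l := by positivity
  have hPpos : 0 < P := by
    have h := ellipticF_strictMono hk Real.pi_pos
    rwa [show ellipticF (β₂ / β₁) 0 = 0 by simp [ellipticF]] at h
  have hS2 := hS.2
  -- Two antiperiods `P` make `2P/l` a period of the wave, and `L` is the least one.
  have h := @hS2 (2 * P / l) ⟨by positivity, fun x => by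
    rw [snoidalWave, snoidalWave, ← hl,
      show l * (x + 2 * P / l) = l * x + P + P by field_simp; ring, jacobiSn_add hk,
      jacobiSn_add hk, neg_neg]⟩
  rw [le_div_iff₀ hlpos] at h
  linarith

/-! ### The eigenfunction `sn · dn` -/

/-- `sn · dn`, the odd eigenfunction of the linearized operator. -/
noncomputable def jacobiSnDn (k u : ℝ) : ℝ :=
  Real.sin (jacobiAm k u) * Real.sqrt (1 - k ^ 2 * Real.sin (jacobiAm k u) ^ 2)

/-- The derivative `cn · (1 - 2 k² sn²)` of `sn · dn`. -/
noncomputable def jacobiSnDnDeriv (k u : ℝ) : ℝ :=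
  Real.cos (jacobiAm k u) * (1 - 2 * k ^ 2 * Real.sin (jacobiAm k u) ^ 2)

theorem jacobiSnDn_hasDerivAt {k : ℝ} (hk : |k| < 1) (u : ℝ) :
    HasDerivAt (jacobiSnDn k) (jacobiSnDnDeriv k u) u := by
  have hA := jacobiAm_hasDerivAt hk u
  have hr := ellipticF_radicand_pos hk (jacobiAm k u)
  have hd : HasDerivAt (fun v => Real.sqrt (1 - k ^ 2 * Real.sin (jacobiAm k v) ^ 2)) _ u :=
    (((hA.sin.pow 2).const_mul (k ^ 2)).const_sub 1).sqrt hr.ne'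
  refine (hA.sin.mul hd).congr_deriv ?_
  have hs := Real.sqrt_pos.2 hr
  have hsq := Real.sq_sqrt hr.le
  rw [jacobiSnDnDeriv]
  simp only [Pi.pow_apply]
  set D := Real.sqrt (1 - k ^ 2 * Real.sin (jacobiAm k u) ^ 2)
  field_simp
  simp only [Nat.cast_ofNat, Nat.add_one_sub_one, pow_one]
  linear_combination 2 * Real.cos (jacobiAm k u) * hsq

/-- This is Lamé's equation for `sn · dn`, with eigenvalue `1 + 4k²`. -/
theorem jacobiSnDnDeriv_hasDerivAt {k : ℝ} (hk : |k| < 1) (u : ℝ) :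
    HasDerivAt (jacobiSnDnDeriv k)
      ((6 * k ^ 2 * jacobiSn u k ^ 2 - (1 + 4 * k ^ 2)) * jacobiSnDn k u) u := by
  have hA := jacobiAm_hasDerivAt hk u
  have h : HasDerivAt (jacobiSnDnDeriv k) _ u :=
    hA.cos.mul (((hA.sin.pow 2).const_mul (2 * k ^ 2)).const_sub 1)
  refine h.congr_deriv ?_
  rw [jacobiSn, jacobiSnDn]
  have hc := Real.sin_sq_add_cos_sq (jacobiAm k u)
  simp only [Nat.cast_ofNat, Nat.add_one_sub_one, pow_one]
  linear_combination (-4 * k ^ 2 * Real.sin (jacobiAm k u) *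
    Real.sqrt (1 - k ^ 2 * Real.sin (jacobiAm k u) ^ 2)) * hc

theorem jacobiSnDn_pos {k u : ℝ} (hk : |k| < 1) (h0 : 0 < u) (h1 : u < ellipticF k Real.pi) :
    0 < jacobiSnDn k u :=
  mul_pos (jacobiSn_pos hk h0 h1) (Real.sqrt_pos.2 (ellipticF_radicand_pos hk _))

theorem jacobiSnDn_neg_of_neg {k u : ℝ} (hk : |k| < 1) (h0 : -ellipticF k Real.pi < u)
    (h1 : u < 0) : jacobiSnDn k u < 0 :=
  mul_neg_of_neg_of_pos (jacobiSn_neg_of_neg hk h0 h1)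
    (Real.sqrt_pos.2 (ellipticF_radicand_pos hk _))

/-! ### Spectral bound on odd functions and coercivity -/

theorem MemH1Per.weakDerivPer_spec {L : ℝ} {f : ℝ → ℝ} (hf : MemH1Per L f) :
    MemL2Per L (weakDerivPer L f) ∧ IsWeakDerivPer L f (weakDerivPer L f) := by
  rw [weakDerivPer, dif_pos hf.2]
  exact hf.2.choose_spec

theorem eq_neg_of_ae_odd {f u : ℝ → ℝ} (hu : Continuous u) (hfu : f =ᵐ[volume] u)
    (hodd : ∀ᵐ x : ℝ, f (-x) = -f x) (x : ℝ) : u (-x) = -u x := by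
  have hneg : ∀ᵐ x : ℝ, f (-x) = u (-x) :=
    (Measure.measurePreserving_neg volume).quasiMeasurePreserving.ae hfu
  have h : (fun x => u (-x)) =ᵐ[volume] fun x => -u x := by
    filter_upwards [hfu, hodd, hneg] with x h1 h2 h3
    rw [← h3, h2, h1]
  exact congrFun ((Continuous.ae_eq_iff_eq volume (by fun_prop) (by fun_prop)).1 h) x

/-- On odd functions the linearized operator is bounded below by `3 β₂² / 2`, the eigenvalue of
the eigenfunction `sn · dn`. -/
theorem integral_odd_linearized_sub_eigenvalue_nonneg {L β₁ β₂ : ℝ} (hβ₁ : 0 < β₁)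
    (hβ : β₂ ^ 2 = 2 - β₁ ^ 2) (hk : |β₂ / β₁| < 1)
    (hS : IsFundamentalPeriod (snoidalWave β₁ β₂) L) {f g : ℝ → ℝ} (hf : MemL2Per L f)
    (hg : MemL2Per L g) (hfg : IsWeakDerivPer L f g) (hodd : ∀ᵐ x : ℝ, f (-x) = -f x) :
    0 ≤ ∫ x in (0 : ℝ)..L,
      (g x ^ 2 + (3 * snoidalWave β₁ β₂ x ^ 2 - 1 - 3 * β₂ ^ 2 / 2) * f x ^ 2) := by
  have hL : 0 < L := hS.1.1
  have hSp : Function.Periodic (snoidalWave β₁ β₂) L := hS.1.2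
  have hhalf := hS.snoidalWave_le hβ₁ hk
  have hSc := continuous_snoidalWave hk
  obtain ⟨u, huc, hup, hfu, huac, hud⟩ := hfg.exists_absolutelyContinuous hL hf hg
  have huodd := eq_neg_of_ae_odd huc hfu hodd
  have hu0 : u 0 = 0 := by
    have := huodd 0
    rw [neg_zero] at this
    linarith
  have huh : u (L / 2) = 0 := by
    have h1 := huodd (L / 2)
    have h2 := hup (-(L / 2))
    rw [show -(L / 2) + L = L / 2 by ring] at h2
    linarith
  have huh' : u (-(L / 2)) = 0 := by rw [huodd, huh, neg_zero]
  set Q : ℝ → ℝ := fun x => 3 * snoidalWave β₁ β₂ x ^ 2 - 1 - 3 * β₂ ^ 2 / 2 with hQ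
  have hQc : Continuous Q := by fun_prop
  have hQp : Function.Periodic Q L := fun x => by simp only [hQ, hSp x]
  set l := β₁ / Real.sqrt 2 with hl
  have hlpos : 0 < l := by positivity
  have hl2 : l ^ 2 = β₁ ^ 2 / 2 := by rw [hl, div_pow, Real.sq_sqrt zero_le_two]
  set k := β₂ / β₁ with hkdef
  have hlin : ∀ x : ℝ, HasDerivAt (fun y : ℝ => l * y) l x := fun x => by
    simpa using (hasDerivAt_id x).const_mul l
  have hφ : ∀ x, HasDerivAt (fun x => jacobiSnDn k (l * x)) (jacobiSnDnDeriv k (l * x) * l) x :=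
    fun x => (jacobiSnDn_hasDerivAt hk (l * x)).comp x (hlin x)
  have hφ' : ∀ x, HasDerivAt (fun x => jacobiSnDnDeriv k (l * x) * l)
      (Q x * jacobiSnDn k (l * x)) x := fun x => by
    have h := ((jacobiSnDnDeriv_hasDerivAt hk (l * x)).comp x (hlin x)).mul_const l
    refine h.congr_deriv ?_
    -- Rescaling Lamé's equation by `l² = β₁²/2` turns `1 + 4k²` into `β₁²/2 + 2β₂²`, which is `1 +
    -- 3β₂²/2` because `β₁² + β₂² = 2`.
    have hQx : Q x = l ^ 2 * (6 * k ^ 2 * jacobiSn (l * x) k ^ 2 - (1 + 4 * k ^ 2)) := by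
      simp only [hQ, snoidalWave, ← hl, ← hkdef]
      rw [hl2, show k ^ 2 = β₂ ^ 2 / β₁ ^ 2 by rw [hkdef, div_pow]]
      field_simp
      linear_combination hβ
    rw [hQx]
    ring
  have hgi : IntervalIntegrable g volume 0 L := hg.2.intervalIntegrable_two hL.le
  have hg2i : IntervalIntegrable (fun x => g x ^ 2) volume 0 L :=
    hg.2.intervalIntegrable_sq hL.le
  have hg2p : Function.Periodic (fun x => g x ^ 2) L := fun x => by simp only [hg.1 x]
  have hg' := hg.1.intervalIntegrable₀ hL.ne' hgi
  have hg2' := hg2p.intervalIntegrable₀ hL.ne' hg2i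
  have hright : 0 ≤ ∫ x in (0 : ℝ)..L / 2, (g x ^ 2 + Q x * u x ^ 2) := by
    refine integral_sq_deriv_add_nonneg_of_pos_solution (by positivity) (huac _ _)
      (hud.mono fun x hx _ => hx) (hg' _ _) (hg2' _ _) hu0 huh hφ hφ' hQc fun x hx => ?_
    refine jacobiSnDn_pos hk (mul_pos hlpos hx.1) (lt_of_lt_of_le ?_ hhalf)
    exact mul_lt_mul_of_pos_left hx.2 hlpos
  -- On the left half `sn · dn` is negative, so its opposite serves as the positive solution.
  have hleft : 0 ≤ ∫ x in -(L / 2)..0, (g x ^ 2 + Q x * u x ^ 2) := by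
    refine integral_sq_deriv_add_nonneg_of_pos_solution (by linarith) (huac _ _)
      (hud.mono fun x hx _ => hx) (hg' _ _) (hg2' _ _) huh' hu0 (fun x => (hφ x).fun_neg)
      (fun x => ((hφ' x).fun_neg).congr_deriv (by ring)) hQc fun x hx => ?_
    refine neg_pos.2 (jacobiSnDn_neg_of_neg hk (lt_of_le_of_lt (neg_le_neg hhalf) ?_)
      (mul_neg_of_pos_of_neg hlpos hx.2))
    have := mul_lt_mul_of_pos_left hx.1 hlpos
    linarith
  have hint : ∀ a b, IntervalIntegrable (fun x => g x ^ 2 + Q x * u x ^ 2) volume a b :=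
    fun a b => (hg2' a b).add (Continuous.intervalIntegrable (by fun_prop) _ _)
  have hper : Function.Periodic (fun x => g x ^ 2 + Q x * u x ^ 2) L := fun x => by
    simp only [hg.1 x, hQp x, hup x]
  have hshift := hper.intervalIntegral_add_eq (-(L / 2)) 0
  rw [show -(L / 2) + L = L / 2 by ring, zero_add,
    ← intervalIntegral.integral_add_adjacent_intervals (hint _ 0) (hint 0 _)] at hshift
  have hfu' : ∫ x in (0 : ℝ)..L, (g x ^ 2 + Q x * f x ^ 2) =
      ∫ x in (0 : ℝ)..L, (g x ^ 2 + Q x * u x ^ 2) := by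
    apply intervalIntegral.integral_congr_ae
    filter_upwards [hfu] with x hx _
    rw [hx]
  rw [hfu', ← hshift]
  exact add_nonneg hleft hright

theorem mainTheorem10 (L β₁ β₂ : ℝ) (hL : 2 * Real.pi < L)
    (hβ₁ : 1 < β₁) (hβ₁' : β₁ < Real.sqrt 2) (hβ₂ : 0 < β₂) (hβ : β₂ ^ 2 = 2 - β₁ ^ 2)
    (hS : IsFundamentalPeriod (snoidalWave β₁ β₂) L)
    (υ : ℝ → ℝ) (hυ : MemH1Per L υ) (hodd : ∀ᵐ x : ℝ, υ (-x) = -υ x) :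
    linearizedPairing L (snoidalWave β₁ β₂) υ υ ≥
      3 * β₂ ^ 2 / (4 + 3 * β₂ ^ 2) * h1NormPer L υ ^ 2 := by
  have hL0 : 0 < L := hS.1.1
  have hk : |β₂ / β₁| < 1 := by
    rw [abs_of_pos (by positivity), div_lt_one (by positivity)]
    nlinarith
  obtain ⟨hg, hgw⟩ := hυ.weakDerivPer_spec
  have hmain := integral_odd_linearized_sub_eigenvalue_nonneg (by positivity) hβ hk hS hυ.1 hg
    hgw hodd
  have hSc := continuous_snoidalWave hk
  have hg2 := hg.2.intervalIntegrable_sq hL0.le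
  have hυ2 := hυ.1.2.intervalIntegrable_sq hL0.le
  rw [h1NormPer, linearizedPairing, Real.sq_sqrt (intervalIntegral.integral_nonneg hL0.le
    fun x _ => by positivity)]
  set g := weakDerivPer L υ
  set S := snoidalWave β₁ β₂
  have hpot : 0 ≤ ∫ x in (0 : ℝ)..L, 3 * S x ^ 2 * υ x ^ 2 :=
    intervalIntegral.integral_nonneg hL0.le fun x _ => by positivity
  have hpoti : IntervalIntegrable (fun x => 3 * S x ^ 2 * υ x ^ 2) volume 0 L :=
    hυ2.continuousOn_mul (by fun_prop)
  have hmaini : IntervalIntegrable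
      (fun x => g x ^ 2 + (3 * S x ^ 2 - 1 - 3 * β₂ ^ 2 / 2) * υ x ^ 2) volume 0 L :=
    hg2.add (hυ2.continuousOn_mul (by fun_prop))
  have hnorm : IntervalIntegrable (fun x => g x ^ 2 + υ x ^ 2) volume 0 L := hg2.add hυ2
  set c := 3 * β₂ ^ 2 / (4 + 3 * β₂ ^ 2) with hc
  have hc0 : 0 ≤ c := by positivity
  have hc1 : 0 ≤ 1 - c := by
    rw [hc, sub_nonneg, div_le_one (by positivity)]
    linarith
  -- The coefficient of `υ²` forces `-1 = c - (1 - c)(1 + 3β₂²/2)`, which determines `c`.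
  have hpt : ∀ x, g x * g x - υ x * υ x + 3 * S x ^ 2 * (υ x * υ x) =
      c * (g x ^ 2 + υ x ^ 2) +
      (1 - c) * (g x ^ 2 + (3 * S x ^ 2 - 1 - 3 * β₂ ^ 2 / 2) * υ x ^ 2) +
      c * (3 * S x ^ 2 * υ x ^ 2) := fun x => by
    rw [hc]
    field_simp
    ring
  simp_rw [hpt]
  rw [intervalIntegral.integral_add ((hnorm.const_mul c).add (hmaini.const_mul (1 - c)))
    (hpoti.const_mul c), intervalIntegral.integral_add (hnorm.const_mul c)
    (hmaini.const_mul (1 - c)), intervalIntegral.integral_const_mul,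
    intervalIntegral.integral_const_mul, intervalIntegral.integral_const_mul]
  have h1 := mul_nonneg hc1 hmain
  have h2 := mul_nonneg hc0 hpot
  linarith
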